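/- Let $n\ge 1$, let $T:\mathbb R^n\rightrightarrows\mathbb R^n$ be a set-valued operator with $\operatorname{zer}T:=\{x : 0\in T(x)\}\neq\emptyset$ and $\operatorname{gph}T:=\{(x,y): y\in T(x)\}$, and let $V\in\mathbb R^{n\times n}$ be symmetric (possibly indefinite), with $q_V(v):=\langle v,Vv\rangle$. Let $P,\Lambda\in\mathbb R^{n\times n}$ be symmetric positive definite with $\Lambda P=P\Lambda$ and $$\Lambda\prec 2\bigl(I+P^{1/2}VP^{1/2}\bigr).$$ Write $\operatorname{dist}_{Q}(x,E):=\inf_{z\in E}\langle z-x,Q(z-x)\rangle^{1/2}$, and let $\|\cdot\|$ denote the spectral norm of a matrix. For $U\subseteq\mathbb R^n\times\mathbb R^n$, the operator $T$ is called $V$-comonotone on $U$ if $\langle x-x',y-y'\rangle\ge q_V(y-y')$ for all $(x,y),(x',y')\in\operatorname{gph}T\cap U$, and maximally $V$-comonotone on $U$ if moreover there is no operator $T'$ that is $V$-comonotone on $U$ with $\operatorname{gph}T\cap U\subsetneq\operatorname{gph}T'\cap U$. Let $S^\star\subseteq\operatorname{zer}T$ be nonempty and convex. **(Local statement.)** Let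 $\delta_1,\delta_2>0$ and suppose that $T$ is maximally $V$-comonotone on $U:=U_1\times U_2$, where $$U_1:=\{z:\operatorname{dist}_{P\Lambda^{-1}}(z,S^\star)\le\delta_1\},\qquad U_2:=\{v:\operatorname{dist}_{P\Lambda^{-1}}(v,\{0\})\le\delta_2\}.$$ Put $$\varepsilon:=\min\left(\frac{\delta_1}{\|I-\Lambda^{-1}\|+\|\Lambda^{-1}\|},\ \frac{\delta_2}{\|P\|\bigl(1+\|I-\Lambda^{-1}\|+\|\Lambda^{-1}\|\bigr)}\right).$$ Then the local assumptions for the relaxed preconditioned proximal point algorithm (PPPA) hold with these $S^\star,V,U,\varepsilon$; that is, in addition to the above conditions on $P$, $\Lambda$, $V$ and $S^\star$: 1. $T$ has $V$-oblique weak Minty solutions at $S^\star$ on $U$: $\langle v,\bar z-z^\star\rangle\ge q_V(v)$ for all $z^\star\in S^\star$ and all $(\bar z,v)\in\operatorname{gph}T\cap U$; 2. $T$ is outer semicontinuous on $U$: if $(x^k,y^k)\in\operatorname{gph}T\cap U$, $x^k\to\bar x$ and $y^k\to\bar y$, then $\bar y\in T(\bar x)$; 3. $\varepsilon>0$, and for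 every $z$ with $\operatorname{dist}_{P\Lambda^{-1}}(z,S^\star)\le\varepsilon$ there exists $\bar z$ with $(\bar z,P(z-\bar z))\in\operatorname{gph}T\cap U$. **(Global statement.)** If $T$ is maximally $V$-comonotone on $\mathbb R^n\times\mathbb R^n$ (that is, $U_1\times U_2$ is replaced by the whole space), then the global PPPA assumptions hold with these $S^\star,V$: items 1 and 2 hold with $U=\mathbb R^n\times\mathbb R^n$, and the preconditioned resolvent $(P+T)^{-1}\circ P$ has full domain, i.e. for every $z\in\mathbb R^n$ there exists $\bar z$ with $P(z-\bar z)\in T(\bar z)$. -/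

import Mathlib

namespace PPPA

/-- The Euclidean space `ℝⁿ`. -/
abbrev Rn (n : ℕ) : Type := EuclideanSpace ℝ (Fin n)

/-- Real `n × n` matrices. -/
abbrev Mat (n : ℕ) : Type := Matrix (Fin n) (Fin n) ℝ

/-- The action `x ↦ A x` of a matrix on Euclidean space, as a bounded linear operator. -/
noncomputable abbrev act {n : ℕ} (A : Mat n) : Rn n →L[ℝ] Rn n :=
  Matrix.toEuclideanCLM (n := Fin n) (𝕜 := ℝ) A

/-- The spectral norm `‖A‖` of a matrix (operator norm induced by the Euclidean norm). -/
noncomputable def matNorm {n : ℕ} (A : Mat n) : ℝ := ‖act A‖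

/-- The quadratic form `q_V(v) = ⟨v, V v⟩`. -/
noncomputable def quadForm {n : ℕ} (V : Mat n) (v : Rn n) : ℝ := inner ℝ v (act V v)

/-- The weighted norm `‖v‖_Q = √⟨v, Q v⟩` (for `Q` positive definite). -/
noncomputable def wNorm {n : ℕ} (Q : Mat n) (v : Rn n) : ℝ := Real.sqrt (quadForm Q v)

/-- The weighted distance `dist_Q(x, E) = inf_{z ∈ E} ‖z - x‖_Q` (for `E` nonempty). -/
noncomputable def wDist {n : ℕ} (Q : Mat n) (x : Rn n) (E : Set (Rn n)) : ℝ :=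
  ⨅ z : E, wNorm Q ((z : Rn n) - x)

/-- A set-valued operator `T : ℝⁿ ⇉ ℝⁿ`. -/
abbrev Operator (n : ℕ) : Type := Rn n → Set (Rn n)

/-- The graph `{(x, y) | y ∈ T x}`. -/
def graph {n : ℕ} (T : Operator n) : Set (Rn n × Rn n) := {p | p.2 ∈ T p.1}

/-- The zeros `{x | 0 ∈ T x}`. -/
def zer {n : ℕ} (T : Operator n) : Set (Rn n) := {x | (0 : Rn n) ∈ T x}

/-- The domain `{x | T x ≠ ∅}`. -/
def dom {n : ℕ} (T : Operator n) : Set (Rn n) := {x | (T x).Nonempty}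

/-- The inverse operator: `x ∈ T⁻¹ y` iff `y ∈ T x`. -/
def inverse {n : ℕ} (T : Operator n) : Operator n := fun y => {x | y ∈ T x}

/-- The operator `P + T : x ↦ P x + T x`. -/
noncomputable def matAdd {n : ℕ} (P : Mat n) (T : Operator n) : Operator n :=
  fun x => {y | ∃ v ∈ T x, y = act P x + v}

/-- The preconditioned resolvent `(P + T)⁻¹ ∘ P`. -/
noncomputable def precondResolvent {n : ℕ} (P : Mat n) (T : Operator n) : Operator n :=
  fun z => inverse (matAdd P T) (act P z)

/-- `T` is `V`-comonotone on `U`. -/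
def ComonotoneOn {n : ℕ} (V : Mat n) (U : Set (Rn n × Rn n)) (T : Operator n) : Prop :=
  ∀ p ∈ graph T ∩ U, ∀ q ∈ graph T ∩ U,
    quadForm V (q.2 - p.2) ≤ inner ℝ (q.1 - p.1) (q.2 - p.2)

/-- `T` is maximally `V`-comonotone on `U`: it is `V`-comonotone on `U`, and no operator that is
`V`-comonotone on `U` has, within `U`, a strictly larger graph. -/
def MaximallyComonotoneOn {n : ℕ} (V : Mat n) (U : Set (Rn n × Rn n)) (T : Operator n) : Prop :=
  ComonotoneOn V U T ∧
    ∀ T' : Operator n, ComonotoneOn V U T' → ¬ (graph T ∩ U ⊂ graph T' ∩ U)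

/-- `T` has `V`-oblique weak Minty solutions at the nonempty convex set `S ⊆ zer T`, on `U`. -/
structure WeakMintyOn {n : ℕ} (V : Mat n) (S : Set (Rn n)) (U : Set (Rn n × Rn n))
    (T : Operator n) : Prop where
  nonempty : S.Nonempty
  convex : Convex ℝ S
  subset_zer : S ⊆ zer T
  minty : ∀ zs ∈ S, ∀ p ∈ graph T ∩ U, quadForm V p.2 ≤ inner ℝ p.2 (p.1 - zs)

/-- `T` is outer semicontinuous on `U`: limits of sequences of points of `graph T ∩ U` belong to
`graph T`. For `U` the whole space this says that the graph of `T` is closed. -/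
def OuterSemicontinuousOn {n : ℕ} (U : Set (Rn n × Rn n)) (T : Operator n) : Prop :=
  ∀ (x y : ℕ → Rn n) (xb yb : Rn n),
    Filter.Tendsto x Filter.atTop (nhds xb) → Filter.Tendsto y Filter.atTop (nhds yb) →
    (∀ k, (x k, y k) ∈ graph T ∩ U) → yb ∈ T xb

open scoped MatrixOrder in
/-- The positive semidefinite square root `P^{1/2}` (for `P` positive semidefinite). -/
noncomputable def matSqrt {n : ℕ} (P : Mat n) : Mat n := CFC.sqrt P

/-- `P` and `Λ` are positive definite, commute, and satisfy `Λ ≺ 2 (I + P^{1/2} V P^{1/2})`. -/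
structure EigCondition {n : ℕ} (P Λ V : Mat n) : Prop where
  posDef_P : P.PosDef
  posDef_Λ : Λ.PosDef
  comm : Λ * P = P * Λ
  eig : ((2 : ℝ) • (1 + matSqrt P * V * matSqrt P) - Λ).PosDef

/-- The set `{z | dist_{P Λ⁻¹}(z, E) ≤ r}`. -/
def wNhd {n : ℕ} (P Λ : Mat n) (E : Set (Rn n)) (r : ℝ) : Set (Rn n) :=
  {z | wDist (P * Λ⁻¹) z E ≤ r}

/-- The local assumptions for the relaxed preconditioned proximal point algorithm, with the data
`S` (solution set), `V`, `U` and `ε` made explicit. -/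
structure LocalAssumption {n : ℕ} (T : Operator n) (P Λ V : Mat n) (S : Set (Rn n))
    (U : Set (Rn n × Rn n)) (ε : ℝ) : Prop where
  symm : V.IsSymm
  weakMinty : WeakMintyOn V S U T
  osc : OuterSemicontinuousOn U T
  eigCondition : EigCondition P Λ V
  eps_pos : 0 < ε
  resolvent : ∀ z ∈ wNhd P Λ S ε, ∃ zb : Rn n, (zb, act P (z - zb)) ∈ graph T ∩ U

/-- The global assumptions for the relaxed preconditioned proximal point algorithm, with the data
`S` (solution set) and `V` made explicit. -/
structure GlobalAssumption {n : ℕ} (T : Operator n) (P Λ V : Mat n) (S : Set (Rn n)) : Prop where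
  symm : V.IsSymm
  weakMinty : WeakMintyOn V S Set.univ T
  osc : OuterSemicontinuousOn Set.univ T
  eigCondition : EigCondition P Λ V
  full_dom : dom (precondResolvent P T) = Set.univ

/-- The constant
`min (δ₁ / (‖I - Λ⁻¹‖ + ‖Λ⁻¹‖)) (δ₂ / (‖P‖ (1 + ‖I - Λ⁻¹‖ + ‖Λ⁻¹‖)))`. -/
noncomputable def epsBound {n : ℕ} (P Λ : Mat n) (δ₁ δ₂ : ℝ) : ℝ :=
  min (δ₁ / (matNorm (1 - Λ⁻¹) + matNorm Λ⁻¹))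
    (δ₂ / (matNorm P * (1 + matNorm (1 - Λ⁻¹) + matNorm Λ⁻¹)))

end PPPA

/-!
The point is the existence of the resolvent point `zb` with `P (z - zb) ∈ T zb`; the weak Minty
inequality is comonotonicity tested against the pairs `(zs, 0)` with `zs ∈ S`, and outer
semicontinuity holds because a limit point in the closed set `U` can be adjoined to the graph.

Existence does not need a globally maximal extension of `T`. By `exists_comonotone_related` every
`z` admits a point `zb` such that `(zb, P (z - zb))` is comonotonically related to the whole of
`graph T ∩ U`. After the shear `(x, y) ↦ (x - V y, y)` this says that a monotone set can be extended
by a point on the graph of `w ↦ z - M w`, where `M = P⁻¹ + V` is positive definite by the eigenvalue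
condition (`EigCondition.posDef_inv_add`). For finite monotone sets the extension lemma is an
application of Sion's minimax theorem (`exists_forall_inner_nonpos_of_fintype`), and compactness of a
sublevel set of the coercive function `w ↦ ⟪x - z + M w, w - y⟫` gives the general case
(`exists_monotone_related`).

It remains to see that this point lies in `U`, for then maximality puts it into the graph
(`MaximallyComonotoneOn.mem_graph`). Since it is related to every `(zs, 0)`, the relaxed step
`z ↦ z - Λ (z - zb)` is Fejér monotone for the `P Λ⁻¹`-norm
(`EigCondition.wNorm_relaxed_step_le`), again by the eigenvalue condition. Writing `zb - zs` and
`P (z - zb)` in terms of `z - zs` and of the relaxed step, and using that all matrices involved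
commute with `P Λ⁻¹`, bounds them by the denominators in `epsBound` times the distance of `z` to `S`
(`EigCondition.wNorm_resolvent_sub_le`, `EigCondition.wNorm_residual_le`).
-/

namespace PPPA

/-! ### Extending monotone and comonotone sets by one point -/

section MonotoneExtension

variable {E : Type*} [NormedAddCommGroup E] [InnerProductSpace ℝ E]

/-- The function `w ↦ ⟪x - z + M w, w - y⟫` is convex when `M` is positive semidefinite: its
second-order part is `w ↦ ⟪M w, w⟫`. -/
lemma convexOn_inner_add_map_sub (M : E →L[ℝ] E) (hM : ∀ w, 0 ≤ inner ℝ (M w) w) (x y z : E)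
    {s : Set E} (hs : Convex ℝ s) :
    ConvexOn ℝ s fun w => inner ℝ (x - z + M w) (w - y) := by
  refine ⟨hs, fun u _ v _ a b ha hb hab => ?_⟩
  obtain rfl : b = 1 - a := by linarith
  have key : a * inner ℝ (x - z + M u) (u - y) + (1 - a) * inner ℝ (x - z + M v) (v - y)
      - inner ℝ (x - z + M (a • u + (1 - a) • v)) (a • u + (1 - a) • v - y)
      = a * (1 - a) * inner ℝ (M (u - v)) (u - v) := by
    simp only [map_add, map_sub, map_smul, inner_add_left, inner_add_right, inner_sub_left,
      inner_sub_right, real_inner_smul_left, real_inner_smul_right]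
    ring
  have := mul_nonneg (mul_nonneg ha hb) (hM (u - v))
  simp only [smul_eq_mul]
  linarith

/-- For a finite monotone family `(x i, y i)` and weights summing to `1`, the weighted average of
`⟪x i - z + M w, w - y i⟫` is nonpositive at the barycentre `w` of the `y i`: the terms that do not
involve `x i` cancel, and twice the rest is minus a double sum of monotonicity gaps. -/
lemma sum_inner_barycentre_nonpos {ι : Type*} [Fintype ι] (x y : ι → E)
    (hxy : ∀ i j, 0 ≤ inner ℝ (x i - x j) (y i - y j)) (M : E →L[ℝ] E) (z : E) (c : ι → ℝ)
    (hc : ∀ i, 0 ≤ c i) (hc1 : ∑ i, c i = 1) :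
    ∑ i, c i * inner ℝ (x i - z + M (∑ j, c j • y j)) ((∑ j, c j • y j) - y i) ≤ 0 := by
  set w := ∑ j, c j • y j with hw
  have h0 : ∑ i, c i * inner ℝ (M w - z) (w - y i) = 0 := by
    have : ∑ i, c i • (w - y i) = 0 := by
      simp_rw [smul_sub, Finset.sum_sub_distrib, ← Finset.sum_smul, hc1, one_smul, ← hw, sub_self]
    rw [← inner_zero_right (𝕜 := ℝ) (M w - z), ← this, inner_sum]
    simp_rw [real_inner_smul_right]
  have hsub : ∀ i, w - y i = ∑ j, c j • (y j - y i) := fun i => by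
    simp_rw [smul_sub, Finset.sum_sub_distrib, ← Finset.sum_smul, hc1, one_smul, ← hw]
  have h1 : ∑ i, c i * inner ℝ (x i) (w - y i)
      = ∑ i, ∑ j, c i * c j * inner ℝ (x i) (y j - y i) := by
    refine Finset.sum_congr rfl fun i _ => ?_
    rw [hsub, inner_sum, Finset.mul_sum]
    simp_rw [real_inner_smul_right, mul_assoc]
  have h2 : ∑ i, ∑ j, c i * c j * inner ℝ (x i) (y j - y i)
      = ∑ i, ∑ j, c i * c j * inner ℝ (x j) (y i - y j) := by
    rw [Finset.sum_comm]
    simp_rw [mul_comm (c _) (c _)]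
  have h3 : ∑ i, ∑ j, c i * c j * inner ℝ (x i) (y j - y i)
      + ∑ i, ∑ j, c i * c j * inner ℝ (x j) (y i - y j)
      = - ∑ i, ∑ j, c i * c j * inner ℝ (x i - x j) (y i - y j) := by
    simp_rw [← Finset.sum_neg_distrib, ← Finset.sum_add_distrib]
    refine Finset.sum_congr rfl fun i _ => Finset.sum_congr rfl fun j _ => ?_
    simp only [inner_sub_left, inner_sub_right]
    ring
  have h4 : 0 ≤ ∑ i, ∑ j, c i * c j * inner ℝ (x i - x j) (y i - y j) :=
    Finset.sum_nonneg fun i _ => Finset.sum_nonneg fun j _ =>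
      mul_nonneg (mul_nonneg (hc i) (hc j)) (hxy i j)
  have h5 : ∑ i, c i * inner ℝ (x i - z + M w) (w - y i)
      = ∑ i, c i * inner ℝ (x i) (w - y i) + ∑ i, c i * inner ℝ (M w - z) (w - y i) := by
    rw [← Finset.sum_add_distrib]
    refine Finset.sum_congr rfl fun i _ => ?_
    rw [← mul_add, ← inner_add_left]
    congr 2
    abel
  linarith

/-- Finite form of the extension lemma. A saddle point of the function
`(w, c) ↦ ∑ i, c i * ⟪x i - z + M w, w - y i⟫`, convex in `w` and linear in `c`, on the convex hull of the `y i` times the standard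
simplex has value at most `0`, by `sum_inner_barycentre_nonpos`. -/
lemma exists_forall_inner_nonpos_of_fintype {ι : Type*} [Fintype ι] [Nonempty ι] (x y : ι → E)
    (hxy : ∀ i j, 0 ≤ inner ℝ (x i - x j) (y i - y j)) (M : E →L[ℝ] E)
    (hM : ∀ w, 0 ≤ inner ℝ (M w) w) (z : E) :
    ∃ w, ∀ i, inner ℝ (x i - z + M w) (w - y i) ≤ 0 := by
  classical
  let F : E → (ι → ℝ) → ℝ := fun w c => ∑ i, c i * inner ℝ (x i - z + M w) (w - y i)
  have hX : Convex ℝ (convexHull ℝ (Set.range y)) := convex_convexHull ℝ _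
  have hY : Convex ℝ (stdSimplex ℝ ι) := convex_stdSimplex ℝ ι
  have hYne : (stdSimplex ℝ ι).Nonempty :=
    ⟨_, single_mem_stdSimplex ℝ (Classical.arbitrary ι)⟩
  have hF1 : ∀ c, Continuous fun w => F w c := fun c => by fun_prop
  have hF2 : ∀ w, Continuous (F w) := fun w => by fun_prop
  have hconv : ∀ c ∈ stdSimplex ℝ ι, ConvexOn ℝ (convexHull ℝ (Set.range y)) fun w => F w c := by
    refine fun c hc => ⟨hX, fun u hu v hv a b ha hb hab => ?_⟩
    simp only [F, smul_eq_mul, Finset.mul_sum, ← Finset.sum_add_distrib]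
    refine Finset.sum_le_sum fun i _ => ?_
    have h := mul_le_mul_of_nonneg_left
      ((convexOn_inner_add_map_sub M hM (x i) (y i) z hX).2 hu hv ha hb hab) (hc.1 i)
    simp only [smul_eq_mul] at h
    linarith
  have hconc : ∀ w, ConcaveOn ℝ (stdSimplex ℝ ι) (F w) := fun w => by
    refine ⟨hY, fun c _ d _ a b _ _ _ => le_of_eq ?_⟩
    simp only [F, smul_eq_mul, Finset.mul_sum, ← Finset.sum_add_distrib, Pi.add_apply,
      Pi.smul_apply]
    exact Finset.sum_congr rfl fun i _ => by ring
  obtain ⟨w, -, c, hc, hsad⟩ := Sion.exists_isSaddlePointOn (f := F)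
    ((Set.range_nonempty y).convexHull) hX ((Set.finite_range y).isCompact_convexHull ℝ)
    (fun c _ => (hF1 c).continuousOn.lowerSemicontinuousOn)
    (fun c hc => (hconv c hc).quasiconvexOn) hY hYne (isCompact_stdSimplex ℝ ι)
    (fun w _ => (hF2 w).continuousOn.upperSemicontinuousOn)
    (fun w _ => (hconc w).quasiconcaveOn)
  refine ⟨w, fun i => ?_⟩
  have hw : ∑ j, c j • y j ∈ convexHull ℝ (Set.range y) :=
    hX.sum_mem (fun j _ => hc.1 j) hc.2 fun j _ => subset_convexHull ℝ _ ⟨j, rfl⟩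
  have h := hsad _ hw _ (single_mem_stdSimplex ℝ i)
  have h' := sum_inner_barycentre_nonpos x y hxy M z c hc.1 hc.2
  have h'' : F w (Pi.single i 1) = inner ℝ (x i - z + M w) (w - y i) := by
    simp [F, Pi.single_apply]
  exact h'' ▸ h.trans h'

/-- **Minty-type extension lemma.** In finite dimension, a monotone set `A` and a coercive linear
map `M` admit, for every `z`, a point `(z - M w, w)` monotonically related to all of `A`. -/
lemma exists_monotone_related [FiniteDimensional ℝ E] (A : Set (E × E))
    (hA : ∀ p ∈ A, ∀ q ∈ A, 0 ≤ inner ℝ (p.1 - q.1) (p.2 - q.2)) (M : E →L[ℝ] E) {c : ℝ}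
    (hc : 0 < c) (hM : ∀ w, c * ‖w‖ ^ 2 ≤ inner ℝ (M w) w) (z : E) :
    ∃ w, ∀ p ∈ A, 0 ≤ inner ℝ (z - M w - p.1) (w - p.2) := by
  classical
  rcases A.eq_empty_or_nonempty with rfl | ⟨p₀, hp₀⟩
  · exact ⟨0, by simp⟩
  have hM0 : ∀ w, 0 ≤ inner ℝ (M w) w := fun w => le_trans (by positivity) (hM w)
  let f : E × E → E → ℝ := fun p w => inner ℝ (p.1 - z + M w) (w - p.2)
  have hf : ∀ p, Continuous (f p) := fun p => by fun_prop
  have hcl : ∀ p, IsClosed {w | f p w ≤ 0} := fun p => isClosed_le (hf p) continuous_const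
  -- Coercivity of `M` makes a single sublevel set bounded, hence compact.
  have hcomp : IsCompact {w | f p₀ w ≤ 0} := by
    refine Metric.isCompact_of_isClosed_isBounded (hcl p₀) ?_
    set b := ‖M‖ * ‖p₀.2‖ + ‖p₀.1 - z‖
    set d := ‖p₀.1 - z‖ * ‖p₀.2‖
    refine (Metric.isBounded_closedBall (x := 0) (r := max 1 ((b + d) / c))).subset
      fun w (hw : f p₀ w ≤ 0) => ?_
    rw [mem_closedBall_zero_iff, le_max_iff, or_iff_not_imp_left, not_le, le_div_iff₀ hc]
    intro h1
    have e : f p₀ w = inner ℝ (M w) w - inner ℝ (M w) p₀.2 + inner ℝ (p₀.1 - z) w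
        - inner ℝ (p₀.1 - z) p₀.2 := by
      simp only [f, inner_add_left, inner_sub_right]
      ring
    have e1 : inner ℝ (M w) p₀.2 ≤ ‖M‖ * ‖w‖ * ‖p₀.2‖ := (real_inner_le_norm _ _).trans
      (mul_le_mul_of_nonneg_right (M.le_opNorm w) (norm_nonneg _))
    have e2 := neg_le_of_abs_le (abs_real_inner_le_norm (p₀.1 - z) w)
    have e3 : inner ℝ (p₀.1 - z) p₀.2 ≤ d := real_inner_le_norm _ _
    have hd : 0 ≤ d := by positivity
    have e4 : c * ‖w‖ ^ 2 ≤ b * ‖w‖ + d := by linarith [hM w]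
    have e5 : d ≤ d * ‖w‖ := le_mul_of_one_le_right hd h1.le
    refine le_of_mul_le_mul_right ?_ (zero_lt_one.trans h1)
    linarith
  obtain ⟨w, -, hw⟩ := hcomp.inter_iInter_nonempty (fun p : A => {w | f p w ≤ 0})
    (fun p => hcl p) fun u => by
      have : Nonempty ↥(insert (⟨p₀, hp₀⟩ : A) u) := ⟨⟨_, Finset.mem_insert_self _ _⟩⟩
      obtain ⟨w, hw⟩ := exists_forall_inner_nonpos_of_fintype
        (ι := ↥(insert (⟨p₀, hp₀⟩ : A) u)) (fun i => i.1.1.1) (fun i => i.1.1.2)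
        (fun i j => hA _ i.1.2 _ j.1.2) M hM0 z
      exact ⟨w, hw ⟨_, Finset.mem_insert_self _ _⟩, Set.mem_iInter₂.2 fun p hp =>
        hw ⟨p, Finset.mem_insert_of_mem hp⟩⟩
  refine ⟨w, fun p hp => ?_⟩
  have h : f p w ≤ 0 := Set.mem_iInter.1 hw ⟨p, hp⟩
  have e : z - M w - p.1 = -(p.1 - z + M w) := by abel
  rw [e, inner_neg_left]
  exact neg_nonneg.2 h

/-- Extension lemma for comonotone sets. The shear `(x, y) ↦ (x - V y, y)` turns a `V`-comonotone
set into a monotone one and the equation `x + R y = z` into `x' + (R + V) y = z`, so that only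
`R + V` has to be coercive and `V` may be indefinite. -/
lemma exists_comonotone_related [FiniteDimensional ℝ E] (V R : E →L[ℝ] E) (A : Set (E × E))
    (hA : ∀ p ∈ A, ∀ q ∈ A, inner ℝ (q.2 - p.2) (V (q.2 - p.2)) ≤ inner ℝ (q.1 - p.1) (q.2 - p.2))
    {c : ℝ} (hc : 0 < c) (hM : ∀ w, c * ‖w‖ ^ 2 ≤ inner ℝ ((R + V) w) w) (z : E) :
    ∃ w, ∀ p ∈ A, inner ℝ (w - p.2) (V (w - p.2)) ≤ inner ℝ (z - R w - p.1) (w - p.2) := by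
  obtain ⟨w, hw⟩ := exists_monotone_related ((fun p : E × E => (p.1 - V p.2, p.2)) '' A) (by
    rintro _ ⟨p, hp, rfl⟩ _ ⟨q, hq, rfl⟩
    have h := hA q hq p hp
    have e : p.1 - V p.2 - (q.1 - V q.2) = (p.1 - q.1) - V (p.2 - q.2) := by
      rw [map_sub]; abel
    dsimp only
    rw [e, inner_sub_left, real_inner_comm (p.2 - q.2) (V _)]
    linarith) (R + V) hc hM z
  refine ⟨w, fun p hp => ?_⟩
  have h := hw _ ⟨p, hp, rfl⟩
  have e : z - (R + V) w - (p.1 - V p.2) = (z - R w - p.1) - V (w - p.2) := by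
    rw [map_sub, add_apply]; abel
  dsimp only at h
  rw [e, inner_sub_left, real_inner_comm (w - p.2) (V _)] at h
  linarith

end MonotoneExtension

/-! ### The action of matrices on Euclidean space -/

section MatrixAction

variable {n : ℕ}

lemma act_mul (A B : Mat n) (v : Rn n) : act (A * B) v = act A (act B v) := by
  rw [act, map_mul]; rfl

lemma act_one (v : Rn n) : act (1 : Mat n) v = v := by
  rw [act, map_one]; rfl

lemma act_add (A B : Mat n) (v : Rn n) : act (A + B) v = act A v + act B v := by
  rw [act, map_add]; rfl

lemma act_sub (A B : Mat n) (v : Rn n) : act (A - B) v = act A v - act B v := by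
  rw [act, map_sub]; rfl

lemma inner_act_left {A : Mat n} (hA : A.IsHermitian) (v w : Rn n) :
    inner ℝ (act A v) w = inner ℝ v (act A w) := by
  have h : (act A).adjoint = act A := by
    rw [← ContinuousLinearMap.star_eq_adjoint, act, ← map_star]
    exact congrArg _ hA
  rw [← ContinuousLinearMap.adjoint_inner_right, h]

lemma quadForm_nonneg {A : Mat n} (hA : A.PosDef) (v : Rn n) : 0 ≤ quadForm A v := by
  have := hA.posSemidef.dotProduct_mulVec_nonneg v.ofLp
  rw [quadForm, Matrix.inner_toEuclideanCLM]
  simpa using this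

lemma quadForm_conj {S : Mat n} (hS : S.IsHermitian) (A : Mat n) (v : Rn n) :
    quadForm (S * A * S) v = quadForm A (act S v) := by
  rw [quadForm, quadForm, act_mul, act_mul, inner_act_left hS]

end MatrixAction

/-! ### Square roots of positive definite matrices -/

section SquareRoot

variable {n : ℕ}

open scoped MatrixOrder in
lemma matSqrt_mul_self {P : Mat n} (hP : P.PosDef) : matSqrt P * matSqrt P = P :=
  CFC.sqrt_mul_sqrt_self P hP.posSemidef.nonneg

open scoped MatrixOrder in
lemma matSqrt_isHermitian (P : Mat n) : (matSqrt P).IsHermitian :=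
  (Matrix.nonneg_iff_posSemidef.1 (CFC.sqrt_nonneg P)).isHermitian

lemma matSqrt_isUnit {P : Mat n} (hP : P.PosDef) : IsUnit (matSqrt P) :=
  isUnit_of_mul_isUnit_left (y := matSqrt P) ((matSqrt_mul_self hP).symm ▸ hP.isUnit)

open scoped MatrixOrder Matrix.Norms.L2Operator in
lemma matSqrt_commute {P A : Mat n} (h : Commute P A) : Commute (matSqrt P) A :=
  Commute.cfcₙ_nnreal h _

lemma quadForm_eq_norm_sq {Q : Mat n} (hQ : Q.PosDef) (v : Rn n) :
    quadForm Q v = ‖act (matSqrt Q) v‖ ^ 2 := by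
  conv_lhs => rw [← matSqrt_mul_self hQ]
  rw [quadForm, act_mul, ← inner_act_left (matSqrt_isHermitian Q), real_inner_self_eq_norm_sq]

/-- The constant comes from the invertibility of `N^{1/2}` and `⟪N w, w⟫ = ‖N^{1/2} w‖ ^ 2`. -/
lemma exists_pos_mul_norm_sq_le {N : Mat n} (hN : N.PosDef) :
    ∃ c : ℝ, 0 < c ∧ ∀ w, c * ‖w‖ ^ 2 ≤ inner ℝ (act N w) w := by
  set k := ‖act (matSqrt N)⁻¹‖
  refine ⟨(k ^ 2 + 1)⁻¹, by positivity, fun w => ?_⟩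
  rw [real_inner_comm, inv_mul_le_iff₀ (by positivity)]
  change _ ≤ _ * quadForm N w
  rw [quadForm_eq_norm_sq hN]
  have h : ‖w‖ ≤ k * ‖act (matSqrt N) w‖ := by
    have h := (act (matSqrt N)⁻¹).le_opNorm (act (matSqrt N) w)
    rwa [← act_mul, Matrix.nonsing_inv_mul _
      ((Matrix.isUnit_iff_isUnit_det _).1 (matSqrt_isUnit hN)), act_one] at h
  have h2 := pow_le_pow_left₀ (norm_nonneg w) h 2
  rw [mul_pow] at h2
  nlinarith [sq_nonneg ‖act (matSqrt N) w‖]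

end SquareRoot

/-! ### Weighted norms and distances -/

section WeightedNorm

variable {n : ℕ} {Q : Mat n}

lemma wNorm_eq_norm (hQ : Q.PosDef) (v : Rn n) : wNorm Q v = ‖act (matSqrt Q) v‖ := by
  rw [wNorm, quadForm_eq_norm_sq hQ, Real.sqrt_sq (norm_nonneg _)]

lemma wNorm_nonneg (Q : Mat n) (v : Rn n) : 0 ≤ wNorm Q v := Real.sqrt_nonneg _

lemma wNorm_neg (Q : Mat n) (v : Rn n) : wNorm Q (-v) = wNorm Q v := by
  simp [wNorm, quadForm]

lemma wNorm_add_le (hQ : Q.PosDef) (v w : Rn n) : wNorm Q (v + w) ≤ wNorm Q v + wNorm Q w := by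
  simp only [wNorm_eq_norm hQ, map_add]
  exact norm_add_le _ _

/-- A matrix commuting with `Q` commutes with `Q^{1/2}`, so its operator norm with respect to the
`Q`-norm is at most its spectral norm. -/
lemma wNorm_act_le (hQ : Q.PosDef) {B : Mat n} (hB : Commute Q B) (v : Rn n) :
    wNorm Q (act B v) ≤ matNorm B * wNorm Q v := by
  rw [wNorm_eq_norm hQ, wNorm_eq_norm hQ, ← act_mul, (matSqrt_commute hB).eq, act_mul]
  exact (act B).le_opNorm _

lemma wDist_le {E : Set (Rn n)} {z : Rn n} (hz : z ∈ E) (x : Rn n) :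
    wDist Q x E ≤ wNorm Q (z - x) :=
  ciInf_le ⟨0, Set.forall_mem_range.2 fun _ => wNorm_nonneg _ _⟩ (⟨z, hz⟩ : E)

lemma le_wDist {E : Set (Rn n)} (hE : E.Nonempty) {x : Rn n} {k r : ℝ} (hk : 0 ≤ k)
    (h : ∀ z ∈ E, r ≤ k * wNorm Q (z - x)) : r ≤ k * wDist Q x E := by
  have := hE.to_subtype
  rw [wDist, Real.mul_iInf_of_nonneg hk]
  exact le_ciInf fun z => h z z.2

lemma continuous_wDist (hQ : Q.PosDef) (E : Set (Rn n)) : Continuous fun x => wDist Q x E := by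
  have : (fun x => wDist Q x E) =
      fun x => Metric.infDist (act (matSqrt Q) x) (act (matSqrt Q) '' E) := by
    funext x
    rw [wDist, Metric.infDist_eq_iInf]
    refine Function.Surjective.iInf_congr _ Set.imageFactorization_surjective fun z => ?_
    rw [wNorm_eq_norm hQ, map_sub, dist_comm, dist_eq_norm]
    rfl
  rw [this]
  exact (Metric.continuous_infDist_pt _).comp (act (matSqrt Q)).continuous

end WeightedNorm

/-! ### The eigenvalue condition and the Fejér estimate -/

section EigCondition

variable {n : ℕ} {P Λ V : Mat n}

lemma isClosed_wNhd (hQ : (P * Λ⁻¹).PosDef) (E : Set (Rn n)) (r : ℝ) :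
    IsClosed (wNhd P Λ E r) :=
  isClosed_le (continuous_wDist hQ E) continuous_const

lemma mem_wNhd_of_mem {E : Set (Rn n)} {z : Rn n} (hz : z ∈ E) {r : ℝ} (hr : 0 ≤ r) :
    z ∈ wNhd P Λ E r :=
  (wDist_le hz z).trans (by simpa [wNorm, quadForm] using hr)

lemma posDef_conj {S A : Mat n} (hS : S.IsHermitian) (hu : IsUnit S) (hA : A.PosDef) :
    (S * A * S).PosDef := by
  have := (Matrix.IsUnit.posDef_star_left_conjugate_iff hu).2 hA
  rwa [show star S = S from hS] at this

namespace EigCondition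

lemma commute_inv (h : EigCondition P Λ V) : Commute P Λ⁻¹ := by
  have hd := (Matrix.isUnit_iff_isUnit_det _).1 h.posDef_Λ.isUnit
  have hc : Λ * P = P * Λ := h.comm
  calc P * Λ⁻¹ = Λ⁻¹ * (Λ * P) * Λ⁻¹ := by
        rw [← mul_assoc, Matrix.nonsing_inv_mul _ hd, one_mul]
    _ = Λ⁻¹ * P := by rw [hc, mul_assoc, mul_assoc, Matrix.mul_nonsing_inv _ hd, mul_one]

lemma posDef_weight (h : EigCondition P Λ V) : (P * Λ⁻¹).PosDef := by
  have := posDef_conj (matSqrt_isHermitian P) (matSqrt_isUnit h.posDef_P) h.posDef_Λ.inv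
  rwa [mul_assoc, ← (matSqrt_commute h.commute_inv).eq, ← mul_assoc,
    matSqrt_mul_self h.posDef_P] at this

lemma weight_mul (h : EigCondition P Λ V) : P * Λ⁻¹ * Λ = P := by
  rw [mul_assoc, Matrix.nonsing_inv_mul _
    ((Matrix.isUnit_iff_isUnit_det _).1 h.posDef_Λ.isUnit), mul_one]

/-- Conjugating `2 (I + P^{1/2} V P^{1/2}) - Λ` by `P^{1/2}` eliminates the square roots. -/
lemma conj_eig (h : EigCondition P Λ V) :
    matSqrt P * ((2 : ℝ) • (1 + matSqrt P * V * matSqrt P) - Λ) * matSqrt P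
      = (2 : ℝ) • (P + P * V * P) - P * Λ := by
  have hS := matSqrt_mul_self h.posDef_P
  have hc : Commute (matSqrt P) Λ := matSqrt_commute h.comm.symm
  have e1 : matSqrt P * (matSqrt P * V * matSqrt P) * matSqrt P = P * V * P := by
    calc _ = (matSqrt P * matSqrt P) * V * (matSqrt P * matSqrt P) := by simp only [mul_assoc]
      _ = _ := by rw [hS]
  have e2 : matSqrt P * Λ * matSqrt P = P * Λ := by
    rw [mul_assoc, ← hc.eq, ← mul_assoc, hS]
  rw [mul_sub, sub_mul, e2, mul_smul_comm, smul_mul_assoc, mul_add, add_mul, e1, mul_one, hS]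

lemma relaxation_nonneg (h : EigCondition P Λ V) (w : Rn n) :
    inner ℝ (act P w) (act Λ w) ≤ 2 * (inner ℝ (act P w) w + quadForm V (act P w)) := by
  have h0 := quadForm_nonneg h.eig (act (matSqrt P) w)
  rw [← quadForm_conj (matSqrt_isHermitian P), h.conj_eig, quadForm, act_sub, act, map_smul,
    smul_apply, act_add, act_mul, act_mul, act_mul, inner_sub_right,
    inner_smul_right, inner_add_right] at h0
  have hP := h.posDef_P.isHermitian
  rw [inner_act_left hP, inner_act_left hP, quadForm, inner_act_left hP]
  linarith

/-- `2 (P⁻¹ + V) = P^{-1/2} (D + Λ) P^{-1/2}` with `D = 2 (I + P^{1/2} V P^{1/2}) - Λ`. -/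
lemma posDef_inv_add (h : EigCondition P Λ V) : (P⁻¹ + V).PosDef := by
  have hd := (Matrix.isUnit_iff_isUnit_det _).1 h.posDef_P.isUnit
  have hS := matSqrt_isHermitian P
  have hu := matSqrt_isUnit h.posDef_P
  have h1 := posDef_conj hS hu (h.eig.add h.posDef_Λ)
  have e : matSqrt P * ((2 : ℝ) • (1 + matSqrt P * V * matSqrt P) - Λ + Λ) * matSqrt P
      = P * ((2 : ℝ) • (P⁻¹ + V)) * P := by
    have h3 := h.conj_eig
    rw [mul_sub, sub_mul] at h3
    have e2 : matSqrt P * Λ * matSqrt P = P * Λ := by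
      rw [mul_assoc, ← (matSqrt_commute h.comm.symm).eq, ← mul_assoc,
        matSqrt_mul_self h.posDef_P]
    rw [e2, sub_left_inj] at h3
    rw [sub_add_cancel, h3, mul_smul_comm, smul_mul_assoc, mul_add, add_mul,
      Matrix.mul_nonsing_inv _ hd, one_mul]
  rw [e] at h1
  have hP : star P = P := h.posDef_P.isHermitian
  have h2 := (Matrix.IsUnit.posDef_star_left_conjugate_iff (U := P) h.posDef_P.isUnit).1
    (by rwa [hP])
  have h3 := h2.smul (show (0 : ℝ) < 2⁻¹ by norm_num)
  rwa [smul_smul, inv_mul_cancel₀ two_ne_zero, one_smul] at h3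

/-- Fejér monotonicity of the relaxed step `z ↦ z - Λ w`, `w = z - zb`: if the Minty inequality
holds at `zs` for the pair `(zb, P w)`, the step does not increase the `P Λ⁻¹`-distance to `zs`. -/
lemma wNorm_relaxed_step_le (h : EigCondition P Λ V) {z zb zs : Rn n}
    (hm : quadForm V (act P (z - zb)) ≤ inner ℝ (act P (z - zb)) (zb - zs)) :
    wNorm (P * Λ⁻¹) (z - zs - act Λ (z - zb)) ≤ wNorm (P * Λ⁻¹) (z - zs) := by
  refine Real.sqrt_le_sqrt ?_
  set w := z - zb
  have ea : zb - zs = (z - zs) - w := by simp only [w]; abel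
  rw [ea, inner_sub_right] at hm
  set a := z - zs
  have hQ := h.posDef_weight.isHermitian
  have hΛ : act (P * Λ⁻¹) (act Λ w) = act P w := by rw [← act_mul, h.weight_mul]
  have h1 : inner ℝ (act Λ w) (act (P * Λ⁻¹) a) = inner ℝ (act P w) a := by
    rw [← inner_act_left hQ, hΛ]
  have hr := h.relaxation_nonneg w
  rw [quadForm, quadForm, map_sub (act (P * Λ⁻¹)), hΛ, inner_sub_left, inner_sub_right, inner_sub_right,
    h1, real_inner_comm (act P w) a, real_inner_comm (act P w) (act Λ w)]
  linarith

/-- The resolvent point is recovered from the relaxed step by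
`zb - zs = (I - Λ⁻¹) (z - zs) + Λ⁻¹ (z - zs - Λ (z - zb))`. -/
lemma wNorm_resolvent_sub_le (h : EigCondition P Λ V) {z zb zs : Rn n}
    (hm : quadForm V (act P (z - zb)) ≤ inner ℝ (act P (z - zb)) (zb - zs)) :
    wNorm (P * Λ⁻¹) (zb - zs)
      ≤ (matNorm (1 - Λ⁻¹) + matNorm Λ⁻¹) * wNorm (P * Λ⁻¹) (z - zs) := by
  have hd := (Matrix.isUnit_iff_isUnit_det _).1 h.posDef_Λ.isUnit
  have e : zb - zs = act (1 - Λ⁻¹) (z - zs) + act Λ⁻¹ (z - zs - act Λ (z - zb)) := by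
    rw [act_sub, act_one, map_sub (act Λ⁻¹) (z - zs), ← act_mul, Matrix.nonsing_inv_mul _ hd,
      act_one]
    abel
  have hc : Commute (P * Λ⁻¹) Λ⁻¹ := h.commute_inv.mul_left (Commute.refl _)
  have hQ := h.posDef_weight
  calc wNorm (P * Λ⁻¹) (zb - zs)
      ≤ wNorm (P * Λ⁻¹) (act (1 - Λ⁻¹) (z - zs))
        + wNorm (P * Λ⁻¹) (act Λ⁻¹ (z - zs - act Λ (z - zb))) := by
        conv_lhs => rw [e]
        exact wNorm_add_le hQ _ _
    _ ≤ matNorm (1 - Λ⁻¹) * wNorm (P * Λ⁻¹) (z - zs)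
        + matNorm Λ⁻¹ * wNorm (P * Λ⁻¹) (z - zs) :=
        add_le_add (wNorm_act_le hQ ((Commute.one_right _).sub_right hc) _)
          ((wNorm_act_le hQ hc _).trans
            (mul_le_mul_of_nonneg_left (h.wNorm_relaxed_step_le hm) (norm_nonneg _)))
    _ = _ := by ring

lemma wNorm_residual_le (h : EigCondition P Λ V) {z zb zs : Rn n}
    (hm : quadForm V (act P (z - zb)) ≤ inner ℝ (act P (z - zb)) (zb - zs)) :
    wNorm (P * Λ⁻¹) (act P (z - zb))
      ≤ matNorm P * (1 + matNorm (1 - Λ⁻¹) + matNorm Λ⁻¹) * wNorm (P * Λ⁻¹) (z - zs) := by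
  have hQ := h.posDef_weight
  have hc : Commute (P * Λ⁻¹) P := (Commute.refl P).mul_left h.commute_inv.symm
  refine (wNorm_act_le hQ hc _).trans ?_
  rw [mul_assoc]
  refine mul_le_mul_of_nonneg_left ?_ (norm_nonneg _)
  have e : z - zb = (z - zs) + -(zb - zs) := by abel
  have h1 := wNorm_add_le hQ (z - zs) (-(zb - zs))
  rw [← e, wNorm_neg] at h1
  linarith [h.wNorm_resolvent_sub_le hm]

end EigCondition

lemma matNorm_sub_add_pos (hn : 1 ≤ n) (A : Mat n) : 0 < matNorm (1 - A) + matNorm A := by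
  have : Nonempty (Fin n) := ⟨⟨0, hn⟩⟩
  have h1 : matNorm (1 : Mat n) = 1 := by rw [matNorm, act, map_one, norm_one]
  have h2 : matNorm (1 : Mat n) ≤ matNorm (1 - A) + matNorm A := by
    have := norm_add_le (act (1 - A)) (act A)
    rwa [← map_add, sub_add_cancel] at this
  linarith

lemma matNorm_pos_of_posDef (hn : 1 ≤ n) (hP : P.PosDef) : 0 < matNorm P := by
  have : Nonempty (Fin n) := ⟨⟨0, hn⟩⟩
  refine norm_pos_iff.2 fun h => hP.isUnit.ne_zero ?_
  exact (map_eq_zero_iff _ (EquivLike.injective Matrix.toEuclideanCLM)).1 h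

lemma epsBound_pos (hn : 1 ≤ n) (hP : P.PosDef) {δ₁ δ₂ : ℝ} (h₁ : 0 < δ₁) (h₂ : 0 < δ₂) :
    0 < epsBound P Λ δ₁ δ₂ := by
  have hk := matNorm_sub_add_pos hn Λ⁻¹
  have hp := matNorm_pos_of_posDef hn hP
  exact lt_min (div_pos h₁ hk) (div_pos h₂ (mul_pos hp (by linarith)))

end EigCondition

/-! ### Consequences of maximal comonotonicity -/

section Maximality

variable {n : ℕ} {P Λ V : Mat n} {T : Operator n} {U : Set (Rn n × Rn n)}

lemma quadForm_neg (V : Mat n) (v : Rn n) : quadForm V (-v) = quadForm V v := by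
  simp [quadForm]

/-- A point of `U` comonotonically related to all of `graph T ∩ U` can be adjoined to `T`, so it
already belongs to the graph when `T` is maximal. -/
lemma MaximallyComonotoneOn.mem_graph (hT : MaximallyComonotoneOn V U T) {p : Rn n × Rn n}
    (hp : p ∈ U)
    (h : ∀ q ∈ graph T ∩ U, quadForm V (p.2 - q.2) ≤ inner ℝ (p.1 - q.1) (p.2 - q.2)) :
    p ∈ graph T := by
  by_contra hpT
  let T' : Operator n := fun x => {y | y ∈ T x ∨ (x, y) = p}
  have hmem : ∀ q, q ∈ graph T' ↔ q ∈ graph T ∨ q = p := fun q => Iff.rfl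
  refine hT.2 T' ?_ ⟨fun q hq => ⟨Or.inl hq.1, hq.2⟩, fun hsub => hpT (hsub ⟨Or.inr rfl, hp⟩).1⟩
  have h' : ∀ q ∈ graph T ∩ U, quadForm V (q.2 - p.2) ≤ inner ℝ (q.1 - p.1) (q.2 - p.2) := by
    intro q hq
    rw [← neg_sub p.2, ← neg_sub p.1, quadForm_neg, inner_neg_neg]
    exact h q hq
  rintro q ⟨hq, hqU⟩ r ⟨hr, hrU⟩
  rcases (hmem q).1 hq with hq' | rfl <;> rcases (hmem r).1 hr with hr' | rfl
  · exact hT.1 q ⟨hq', hqU⟩ r ⟨hr', hrU⟩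
  · exact h q ⟨hq', hqU⟩
  · exact h' r ⟨hr', hrU⟩
  · simp [quadForm]

lemma MaximallyComonotoneOn.outerSemicontinuousOn (hT : MaximallyComonotoneOn V U T)
    (hU : IsClosed U) : OuterSemicontinuousOn U T := by
  intro x y xb yb hx hy hxy
  have hlim := hx.prodMk_nhds hy
  refine hT.mem_graph (hU.mem_of_tendsto hlim (.of_forall fun k => (hxy k).2)) fun q hq => ?_
  have hcl : IsClosed {p : Rn n × Rn n |
      quadForm V (p.2 - q.2) ≤ inner ℝ (p.1 - q.1) (p.2 - q.2)} := by
    unfold quadForm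
    exact isClosed_le (by fun_prop) (by fun_prop)
  exact hcl.mem_of_tendsto hlim (.of_forall fun k => hT.1 q hq _ (hxy k))

lemma ComonotoneOn.weakMintyOn (hT : ComonotoneOn V U T) {S : Set (Rn n)} (hSne : S.Nonempty)
    (hSconv : Convex ℝ S) (hSzer : S ⊆ zer T) (hSU : ∀ zs ∈ S, (zs, (0 : Rn n)) ∈ U) :
    WeakMintyOn V S U T where
  nonempty := hSne
  convex := hSconv
  subset_zer := hSzer
  minty zs hzs p hp := by
    simpa [real_inner_comm] using hT (zs, 0) ⟨hSzer hzs, hSU zs hzs⟩ p hp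

/-- Every `z` has a candidate resolvent point comonotonically related to the graph of `T` in `U`;
it need not lie in `U`. -/
lemma EigCondition.exists_related (h : EigCondition P Λ V) (hT : ComonotoneOn V U T) (z : Rn n) :
    ∃ zb, ∀ q ∈ graph T ∩ U,
      quadForm V (act P (z - zb) - q.2) ≤ inner ℝ (zb - q.1) (act P (z - zb) - q.2) := by
  obtain ⟨c, hc, hN⟩ := exists_pos_mul_norm_sq_le h.posDef_inv_add
  obtain ⟨w, hw⟩ := exists_comonotone_related (act V) (act P⁻¹) (graph T ∩ U) hT hc
    (fun w => by simpa only [act, map_add] using hN w) z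
  have hd := (Matrix.isUnit_iff_isUnit_det _).1 h.posDef_P.isUnit
  refine ⟨z - act P⁻¹ w, fun q hq => ?_⟩
  rw [sub_sub_cancel, ← act_mul, Matrix.mul_nonsing_inv _ hd, act_one]
  exact hw q hq

end Maximality

end PPPA

theorem mainTheorem6 (n : ℕ) (hn : 1 ≤ n) (T : PPPA.Operator n) (hT : (PPPA.zer T).Nonempty)
    (P Λ V : PPPA.Mat n) (hV : V.IsSymm) (hPΛ : PPPA.EigCondition P Λ V)
    (S : Set (PPPA.Rn n)) (hSne : S.Nonempty) (hSconv : Convex ℝ S) (hSzer : S ⊆ PPPA.zer T) :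
    (∀ δ₁ δ₂ : ℝ, 0 < δ₁ → 0 < δ₂ →
      PPPA.MaximallyComonotoneOn V (PPPA.wNhd P Λ S δ₁ ×ˢ PPPA.wNhd P Λ {0} δ₂) T →
      PPPA.LocalAssumption T P Λ V S (PPPA.wNhd P Λ S δ₁ ×ˢ PPPA.wNhd P Λ {0} δ₂)
        (PPPA.epsBound P Λ δ₁ δ₂)) ∧
    (PPPA.MaximallyComonotoneOn V Set.univ T → PPPA.GlobalAssumption T P Λ V S) := by
  open PPPA in
  have hQ := hPΛ.posDef_weight
  refine ⟨fun δ₁ δ₂ h₁ h₂ hmax => ?_, fun hmax => ?_⟩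
  · have hSU : ∀ zs ∈ S, (zs, (0 : Rn n)) ∈ wNhd P Λ S δ₁ ×ˢ wNhd P Λ {0} δ₂ := fun zs hzs =>
      ⟨mem_wNhd_of_mem hzs h₁.le, mem_wNhd_of_mem (Set.mem_singleton _) h₂.le⟩
    refine ⟨hV, hmax.1.weakMintyOn hSne hSconv hSzer hSU,
      hmax.outerSemicontinuousOn ((isClosed_wNhd hQ _ _).prod (isClosed_wNhd hQ _ _)), hPΛ,
      epsBound_pos hn hPΛ.posDef_P h₁ h₂, fun z hz => ?_⟩
    obtain ⟨zb, hzb⟩ := hPΛ.exists_related hmax.1 z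
    -- Relatedness to the zeros `(zs, 0)` is the Minty inequality that drives the Fejér estimate.
    have hm : ∀ zs ∈ S, quadForm V (act P (z - zb)) ≤ inner ℝ (act P (z - zb)) (zb - zs) :=
      fun zs hzs => by simpa [real_inner_comm] using hzb (zs, 0) ⟨hSzer hzs, hSU zs hzs⟩
    have hswap : ∀ zs, wNorm (P * Λ⁻¹) (z - zs) = wNorm (P * Λ⁻¹) (zs - z) := fun zs => by
      rw [← wNorm_neg, neg_sub]
    have hk := matNorm_sub_add_pos hn Λ⁻¹
    have hp : 0 < matNorm P * (1 + matNorm (1 - Λ⁻¹) + matNorm Λ⁻¹) :=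
      mul_pos (matNorm_pos_of_posDef hn hPΛ.posDef_P) (by linarith)
    have hzε : wDist (P * Λ⁻¹) z S ≤ epsBound P Λ δ₁ δ₂ := hz
    have hU : (zb, act P (z - zb)) ∈ wNhd P Λ S δ₁ ×ˢ wNhd P Λ {0} δ₂ := by
      constructor
      · have h := le_wDist (Q := P * Λ⁻¹) (x := z) (r := wDist (P * Λ⁻¹) zb S) hSne hk.le
          fun zs hzs => by
            rw [← hswap]
            refine (wDist_le hzs zb).trans ?_
            rw [← wNorm_neg, neg_sub]
            exact hPΛ.wNorm_resolvent_sub_le (hm zs hzs)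
        exact h.trans ((le_div_iff₀' hk).1 (hzε.trans (min_le_left _ _)))
      · have h := le_wDist (Q := P * Λ⁻¹) (x := z)
          (r := wDist (P * Λ⁻¹) (act P (z - zb)) {0}) hSne hp.le fun zs hzs => by
            rw [← hswap]
            refine (wDist_le (Set.mem_singleton _) (act P (z - zb))).trans ?_
            rw [zero_sub, wNorm_neg]
            exact hPΛ.wNorm_residual_le (hm zs hzs)
        exact h.trans ((le_div_iff₀' hp).1 (hzε.trans (min_le_right _ _)))
    exact ⟨zb, hmax.mem_graph hU hzb, hU⟩
  · refine ⟨hV, hmax.1.weakMintyOn hSne hSconv hSzer fun _ _ => Set.mem_univ _,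
      hmax.outerSemicontinuousOn isClosed_univ, hPΛ, Set.eq_univ_of_forall fun z => ?_⟩
    obtain ⟨zb, hzb⟩ := hPΛ.exists_related hmax.1 z
    have hmem := hmax.mem_graph (p := (zb, act P (z - zb))) (Set.mem_univ _) hzb
    exact ⟨zb, act P (z - zb), hmem, by rw [map_sub, add_sub_cancel]⟩
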